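/- Work over $\mathbb{C}$. A conic in $\mathbb{P}^3$ is a (possibly reducible or non-reduced) plane curve of degree $2$. Conics are identified with their Chow forms, that is, with points of $\mathrm{Ch}_{\mathrm{plane}}(2,\mathbb{P}^3)\subseteq\mathbb{P}^{20}$, where $\mathbb{P}^{20}$ is the space of quadratic forms in the six Plücker coordinates of lines in $\mathbb{P}^3$; convergence of conics means convergence of these points in the Euclidean topology of $\mathbb{P}^{20}$. (If the conic $\beta$ is cut out in the plane $h^\top x=0$ by a quadratic form $Q$ that does not vanish identically on this plane, then its Chow form is $p\mapsto Q(h\lrcorner p)$, where $h\lrcorner (u\wedge v)=(h^\top u)\,v-(h^\top v)\,u$; it vanishes exactly at the lines that meet $\beta$.) Theorem 4.10. Let $X_1,\ldots,X_7$ be distinct points of $\mathbb{P}^3$ on an irreducible conic $\beta$. Then for generic lines $L_1,\ldots,L_7$ in $\mathbb{P}^3$ through $X_1,\ldots,X_7$, respectively, there is a sequence of conics $\beta_n\to\beta$ in the Euclidean topology such that each $\beta_n$ meets every $L_i$ but contains none of the points $X_1,\ldots,X_7$. Here "generic" means: for all tuples $(L_1,\ldots,L_7)$ in a nonempty Zariski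 open subset, depending only on $\beta$ and $X_1,\ldots,X_7$, of the variety $\{(L_1,\ldots,L_7)\in\mathrm{Gr}(1,\mathbb{P}^3)^7 : X_i\in L_i \text{ for all } i\}\cong(\mathbb{P}^2)^7$. -/

import Mathlib

open Filter Topology
open scoped LinearAlgebra.Projectivization Matrix

/-- The Euclidean topology on the projective space of a topological vector space: the quotient
topology of the space of nonzero vectors. -/
noncomputable instance projectivizationTopology {V : Type*} [AddCommGroup V] [Module ℂ V] [TopologicalSpace V] :
    TopologicalSpace (ℙ ℂ V) :=
  TopologicalSpace.coinduced (Projectivization.mk' ℂ) inferInstance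

/-- Points of complex projective 3-space. -/
abbrev P3 : Type := ℙ ℂ (Fin 4 → ℂ)

/-- Lines of complex projective 3-space, as 2-dimensional linear subspaces of `ℂ⁴`. -/
def Line3 : Type := {W : Submodule ℂ (Fin 4 → ℂ) // Module.finrank ℂ W = 2}

/-- The point `X` lies on the line `L`. -/
def Line3.Through (L : Line3) (X : P3) : Prop := X.submodule ≤ L.1

/-- The Plücker vector of a pair of vectors: the `2 × 2` minors with column indices
`01, 02, 03, 12, 13, 23`. -/
def plucker (u v : Fin 4 → ℂ) : Fin 6 → ℂ :=
  ![u 0 * v 1 - u 1 * v 0, u 0 * v 2 - u 2 * v 0, u 0 * v 3 - u 3 * v 0,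
    u 1 * v 2 - u 2 * v 1, u 1 * v 3 - u 3 * v 1, u 2 * v 3 - u 3 * v 2]

/-- Zariski closed subsets of a product of copies of the Grassmannian of lines in `ℙ³`, with each
factor in its Plücker embedding.  A polynomial vanishes at a tuple of lines if it vanishes at all
homogeneous Plücker coordinates of the tuple.  Since every rescaling of the Plücker vectors comes
from some choice of spanning vectors, this is the same as the vanishing of all multihomogeneous
components of the polynomial. -/
def IsZariskiClosedLines {m : ℕ} (Z : Set (Fin m → Line3)) : Prop :=
  ∃ S : Set (MvPolynomial (Fin m × Fin 6) ℂ),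
    Z = {L | ∀ f ∈ S, ∀ u v : Fin m → Fin 4 → ℂ,
      (∀ i, Submodule.span ℂ {u i, v i} = (L i).1) →
        MvPolynomial.eval (fun k : Fin m × Fin 6 => plucker (u k.1) (v k.1) k.2) f = 0}

/-- The property `P` holds for generic lines through the given points: it holds on a nonempty
Zariski open subset of the irreducible variety of all tuples of lines whose `i`-th member passes
through `X i` (a product of projective planes). -/
def HoldsForGenericLinesThrough {m : ℕ} (X : Fin m → P3) (P : (Fin m → Line3) → Prop) : Prop :=
  ∃ Z : Set (Fin m → Line3), IsZariskiClosedLines Z ∧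
    (∃ L, (∀ i, (L i).Through (X i)) ∧ L ∉ Z) ∧
    ∀ L, (∀ i, (L i).Through (X i)) → L ∉ Z → P L

/-- A (possibly reducible or nonreduced) conic curve in `ℙ³`: a plane `normal · x = 0`, together
with a quadratic form `xᵀ A x` that does not vanish identically on that plane. -/
structure PlaneConic where
  normal : Fin 4 → ℂ
  form : Matrix (Fin 4) (Fin 4) ℂ
  normal_ne_zero : normal ≠ 0
  form_symm : form.IsSymm
  form_nonzero : ∃ y, normal ⬝ᵥ y = 0 ∧ y ⬝ᵥ form *ᵥ y ≠ 0

/-- The matrix that sends the Plücker vector of a line to the point where the line meets the plane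
with normal vector `h` (and to zero if the line lies in the plane). -/
def planeSection (h : Fin 4 → ℂ) : Matrix (Fin 4) (Fin 6) ℂ :=
  !![-h 1, -h 2, -h 3, 0, 0, 0;
     h 0, 0, 0, -h 2, -h 3, 0;
     0, h 0, 0, h 1, 0, -h 3;
     0, 0, h 0, 0, h 1, h 2]

theorem planeSection_mulVec_plucker (h u v : Fin 4 → ℂ) :
    planeSection h *ᵥ plucker u v = (h ⬝ᵥ u) • v - (h ⬝ᵥ v) • u := by
  ext i
  fin_cases i <;>
    simp [planeSection, plucker, Matrix.mulVec, dotProduct, Fin.sum_univ_succ] <;> ring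

/-- Symmetric `6 × 6` matrices, i.e. quadratic forms in the six Plücker coordinates. -/
def symMatrices : Submodule ℂ (Matrix (Fin 6) (Fin 6) ℂ) where
  carrier := {M | M.IsSymm}
  add_mem' := fun ha hb => ha.add hb
  zero_mem' := Matrix.isSymm_zero
  smul_mem' := fun c _ ha => ha.smul c

/-- The space `ℙ²⁰` of quadratic forms in the six Plücker coordinates. -/
abbrev P20 : Type := ℙ ℂ symMatrices

namespace PlaneConic

/-- The symmetric matrix of the quadratic form `p ↦ Q(planeSection p)` in the Plücker
coordinates `p`, where `Q` is the quadratic form of the conic. -/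
def chowMatrix (β : PlaneConic) : Matrix (Fin 6) (Fin 6) ℂ :=
  (planeSection β.normal)ᵀ * β.form * planeSection β.normal

theorem chowMatrix_symm (β : PlaneConic) : β.chowMatrix ∈ symMatrices := by
  change (_ : Matrix _ _ ℂ)ᵀ = _
  simp [chowMatrix, Matrix.transpose_mul, β.form_symm.eq, Matrix.mul_assoc]

theorem dotProduct_chowMatrix (β : PlaneConic) (p : Fin 6 → ℂ) :
    p ⬝ᵥ β.chowMatrix *ᵥ p =
      (planeSection β.normal *ᵥ p) ⬝ᵥ β.form *ᵥ (planeSection β.normal *ᵥ p) := by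
  rw [chowMatrix, Matrix.mul_assoc, ← Matrix.mulVec_mulVec, ← Matrix.mulVec_mulVec,
    Matrix.dotProduct_mulVec, Matrix.vecMul_transpose]

theorem chowMatrix_ne_zero (β : PlaneConic) : β.chowMatrix ≠ 0 := by
  intro h0
  obtain ⟨y, hy, hne⟩ := β.form_nonzero
  obtain ⟨i, hi⟩ := Function.ne_iff.mp β.normal_ne_zero
  have hi' : β.normal i ≠ 0 := hi
  have key := β.dotProduct_chowMatrix (plucker (Pi.single i (β.normal i)⁻¹) y)
  rw [planeSection_mulVec_plucker, hy, h0] at key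
  simp [hi'] at key
  exact hne key.symm

/-- The Chow form of a conic, a point of `ℙ²⁰`.  It vanishes at a line if and only if the line
meets the conic. -/
noncomputable def chowForm (β : PlaneConic) : P20 :=
  Projectivization.mk ℂ (⟨β.chowMatrix, β.chowMatrix_symm⟩ : symMatrices)
    (fun h => β.chowMatrix_ne_zero (congrArg Subtype.val h))

/-- The Euclidean topology on conics, which are identified with their Chow forms in `ℙ²⁰`. -/
noncomputable instance : TopologicalSpace PlaneConic := TopologicalSpace.induced chowForm inferInstance

/-- The set of points of a conic. -/
def points (β : PlaneConic) : Set P3 :=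
  {X | ∀ x ∈ X.submodule, β.normal ⬝ᵥ x = 0 ∧ x ⬝ᵥ β.form *ᵥ x = 0}

/-- The conic meets the line. -/
def Meets (β : PlaneConic) (L : Line3) : Prop := ∃ Y ∈ β.points, L.Through Y

/-- The conic is irreducible: on its plane, the quadratic form is not a product of two linear
forms. -/
def IsIrreducible (β : PlaneConic) : Prop :=
  ¬ ∃ a b : Fin 4 → ℂ, ∀ x, β.normal ⬝ᵥ x = 0 → x ⬝ᵥ β.form *ᵥ x = (a ⬝ᵥ x) * (b ⬝ᵥ x)

end PlaneConic

/-! The proof is a first-order deformation argument. Parametrize `β` by a quadratic curve `t ↦ pt t`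
with `X i = pt (t i)`. Perturb the normal vector `h` and the quadratic form `A`; along the curve the
perturbations restrict to polynomials `l` of degree at most 2 and `q` of degree at most 4. If `p i`
on `L i` is normalized by `h ⬝ᵥ p i = 1`, incidence with `L i` reads, to first order, `q (t i) + c i
* l (t i) = 0` with `c i = -2 * (pt (t i) ⬝ᵥ A *ᵥ p i)`. These are seven equations in 5 + 3
unknowns. If they are independent, the implicit function theorem gives a curve of conics meeting all
lines, tangent to a kernel vector `(q, l)`; the plane leaves `X i` as soon as `l (t i) ≠ 0`
(`Frame.exists_tendsto`).

To eliminate `q`: values at the seven nodes come from a quartic iff the weights `μ i` and `μ i * t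
i` annihilate them, where `μ` reads off the coefficient of `t ^ 6`. This leaves two equations for
`l`, with rows `(s 0, s 1, s 2)` and `(s 1, s 2, s 3)` for the moments `s k = ∑ i, μ i * c i * t i ^
k`. Their cross product `momentCross s` is a solution, and it is nonzero exactly when the rank is
two. So one condition, that the quadratic polynomial `momentCross s` vanishes at no node, gives both
independence and escape from the points.

Since `c i` is a quotient of linear forms in the Plücker coordinates of `L i`, the condition is
Zariski open (`exists_genericity_polynomial`). Every `c` is realized by suitable lines, and one
choice makes the polynomial constant (`exists_moments_eq`), so the open set is nonempty. -/

/-! ### Interpolation at seven nodes and the moment equations -/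

section Interpolation

/-- Weights of the functional that sends values at the nodes `t` to the top coefficient of the
interpolating polynomial. -/
theorem exists_topCoeff_weights {t : Fin 7 → ℂ} (ht : Function.Injective t) :
    ∃ μ : Fin 7 → ℂ, ∀ k : Fin 7, ∑ i, μ i * t i ^ (k : ℕ) = if k = 6 then 1 else 0 := by
  have hu : IsUnit (Matrix.vandermonde t).det :=
    isUnit_iff_ne_zero.2 (Matrix.det_vandermonde_ne_zero_iff.2 ht)
  refine ⟨fun i => (Matrix.vandermonde t)⁻¹ 6 i, fun k => ?_⟩
  have := congrFun (congrFun (Matrix.nonsing_inv_mul _ hu) 6) k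
  rw [Matrix.mul_apply, Matrix.one_apply] at this
  simpa [Matrix.vandermonde_apply, eq_comm] using this

/-- Values at seven nodes that are killed by the two top functionals are interpolated by a
polynomial of degree at most four. -/
theorem exists_quartic_interpolation {t μ : Fin 7 → ℂ} (ht : Function.Injective t)
    (hμ : ∀ k : Fin 7, ∑ i, μ i * t i ^ (k : ℕ) = if k = 6 then 1 else 0)
    {b : Fin 7 → ℂ} (h0 : ∑ i, μ i * b i = 0) (h1 : ∑ i, μ i * t i * b i = 0) :
    ∃ q : Fin 5 → ℂ, ∀ i, ∑ k, q k * t i ^ (k : ℕ) = b i := by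
  have hu : IsUnit (Matrix.vandermonde t).det :=
    isUnit_iff_ne_zero.2 (Matrix.det_vandermonde_ne_zero_iff.2 ht)
  obtain ⟨a, ha⟩ : ∃ a, Matrix.vandermonde t *ᵥ a = b :=
    ⟨(Matrix.vandermonde t)⁻¹ *ᵥ b, by
      rw [Matrix.mulVec_mulVec, Matrix.mul_nonsing_inv _ hu, Matrix.one_mulVec]⟩
  have hb : ∀ i, ∑ k, a k * t i ^ (k : ℕ) = b i := fun i => by
    rw [← ha]
    simp [Matrix.mulVec, dotProduct, Matrix.vandermonde_apply, mul_comm]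
  -- The weights `μ` applied to the interpolating polynomial of degree at most 6 return its top
  -- coefficient.
  have h6 : a 6 = 0 := by
    have : ∑ i, μ i * b i = ∑ k, a k * ∑ i, μ i * t i ^ (k : ℕ) := by
      simp_rw [← hb, Finset.mul_sum]
      rw [Finset.sum_comm]
      exact Finset.sum_congr rfl fun _ _ => Finset.sum_congr rfl fun _ _ => by ring
    rw [h0] at this
    simpa [hμ] using this.symm
  -- With `a 6 = 0` known, the uncontrolled seventh moment of `μ` drops out, and `μ i * t i` reads
  -- off `a 5`.
  have h5 : a 5 = 0 := by
    have : ∑ i, μ i * t i * b i = ∑ k : Fin 6, a k.castSucc * ∑ i, μ i * t i ^ (k.succ : ℕ) := by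
      simp_rw [← hb, Finset.mul_sum]
      rw [Finset.sum_comm, Fin.sum_univ_castSucc]
      have : a (Fin.last 6) = 0 := h6
      simp only [this, zero_mul, mul_zero, Finset.sum_const_zero, add_zero]
      exact Finset.sum_congr rfl fun _ _ => Finset.sum_congr rfl fun _ _ => by
        simp only [Fin.val_castSucc, Fin.val_succ]; ring
    rw [h1] at this
    simp_rw [hμ] at this
    simpa [Fin.sum_univ_succ, Fin.ext_iff] using this.symm
  refine ⟨fun k => a (k.castLE (by norm_num)), fun i => ?_⟩
  rw [← hb i]
  conv_rhs => rw [Fin.sum_univ_castSucc, Fin.sum_univ_castSucc]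
  have e6 : a (Fin.last 6) = 0 := h6
  have e5 : a (Fin.last 5).castSucc = 0 := h5
  rw [e5, e6]
  simp [Fin.castLE, Fin.castSucc, Fin.castAdd]

/-- The coefficients of the quadratic polynomial that solves
`∑ i, μ i * c i * ℓ (t i) = ∑ i, μ i * c i * t i * ℓ (t i) = 0`, in terms of the moments
`s k = ∑ i, μ i * c i * t i ^ k`. -/
def momentCross {R : Type*} [CommRing R] (s : Fin 4 → R) : Fin 3 → R :=
  ![s 1 * s 3 - s 2 ^ 2, s 1 * s 2 - s 0 * s 3, s 0 * s 2 - s 1 ^ 2]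

/-- The moments of `c` with respect to the weights `μ` at the nodes `t`. -/
def moments (t μ c : Fin 7 → ℂ) (k : Fin 4) : ℂ := ∑ i, μ i * c i * t i ^ (k : ℕ)

theorem sum_weight_mul_quadratic (t μ c : Fin 7 → ℂ) (l : Fin 3 → ℂ) :
    ∑ i, μ i * (c i * ∑ j, l j * t i ^ (j : ℕ)) =
      l 0 * moments t μ c 0 + l 1 * moments t μ c 1 + l 2 * moments t μ c 2 := by
  simp only [moments, Finset.mul_sum, ← Finset.sum_add_distrib]
  refine Finset.sum_congr rfl fun i _ => ?_
  simp [Fin.sum_univ_three]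
  ring

theorem sum_weight_mul_node_mul_quadratic (t μ c : Fin 7 → ℂ) (l : Fin 3 → ℂ) :
    ∑ i, μ i * t i * (c i * ∑ j, l j * t i ^ (j : ℕ)) =
      l 0 * moments t μ c 1 + l 1 * moments t μ c 2 + l 2 * moments t μ c 3 := by
  simp only [moments, Finset.mul_sum, ← Finset.sum_add_distrib]
  refine Finset.sum_congr rfl fun i _ => ?_
  simp [Fin.sum_univ_three]
  ring

/-- The kernel vector of the linearized system: a cross product is orthogonal to both moment rows,
so both top functionals kill the values left for the quartic. -/
theorem exists_quartic_of_momentCross {t μ : Fin 7 → ℂ} (ht : Function.Injective t)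
    (hμ : ∀ k : Fin 7, ∑ i, μ i * t i ^ (k : ℕ) = if k = 6 then 1 else 0) (c : Fin 7 → ℂ) :
    ∃ q : Fin 5 → ℂ, ∀ i, ∑ k, q k * t i ^ (k : ℕ) +
      c i * ∑ j, momentCross (moments t μ c) j * t i ^ (j : ℕ) = 0 := by
  obtain ⟨q, hq⟩ := exists_quartic_interpolation ht hμ
    (b := fun i => -(c i * ∑ j, momentCross (moments t μ c) j * t i ^ (j : ℕ)))
    (by
      simp only [mul_neg, Finset.sum_neg_distrib, sum_weight_mul_quadratic]
      simp [momentCross]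
      ring)
    (by
      simp only [mul_neg, Finset.sum_neg_distrib, sum_weight_mul_node_mul_quadratic]
      simp [momentCross]
      ring)
  exact ⟨q, fun i => by rw [hq i]; ring⟩

theorem exists_solution_of_det_ne_zero {a b c d : ℂ} (h : a * d - b * c ≠ 0) (v w : ℂ) :
    ∃ x y, x * a + y * b = v ∧ x * c + y * d = w := by
  refine ⟨(v * d - w * b) / (a * d - b * c), (w * a - v * c) / (a * d - b * c), ?_, ?_⟩ <;>
  · rw [div_mul_eq_mul_div, div_mul_eq_mul_div, ← add_div, div_eq_iff h]
    ring

/-- Two linear equations in three unknowns are solvable if the cross product of the coefficient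
vectors does not vanish. -/
theorem exists_solution_of_momentCross_ne_zero {s : Fin 4 → ℂ} (hs : momentCross s ≠ 0) (v w : ℂ) :
    ∃ l : Fin 3 → ℂ, l 0 * s 0 + l 1 * s 1 + l 2 * s 2 = v ∧
      l 0 * s 1 + l 1 * s 2 + l 2 * s 3 = w := by
  by_cases h0 : s 1 * s 3 - s 2 * s 2 = 0
  · by_cases h1 : s 0 * s 3 - s 2 * s 1 = 0
    · have h2 : s 0 * s 2 - s 1 * s 1 ≠ 0 := fun h2 => hs (by
        ext j
        fin_cases j
        · simpa [momentCross, sq] using h0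
        · simp only [momentCross]
          change s 1 * s 2 - s 0 * s 3 = 0
          linear_combination -h1
        · simpa [momentCross, sq] using h2)
      obtain ⟨x, y, hx, hy⟩ := exists_solution_of_det_ne_zero h2 v w
      exact ⟨![x, y, 0], by simpa using hx, by simpa using hy⟩
    · obtain ⟨x, y, hx, hy⟩ := exists_solution_of_det_ne_zero h1 v w
      exact ⟨![x, 0, y], by simpa using hx, by simpa using hy⟩
  · obtain ⟨x, y, hx, hy⟩ := exists_solution_of_det_ne_zero h0 v w
    exact ⟨![0, x, y], by simpa using hx, by simpa using hy⟩

/-- Surjectivity of the linearized system: `l` is chosen to match the two top functionals of `b`,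
and a quartic interpolates the remainder. -/
theorem exists_quartic_add_mul_quadratic {t μ : Fin 7 → ℂ} (ht : Function.Injective t)
    (hμ : ∀ k : Fin 7, ∑ i, μ i * t i ^ (k : ℕ) = if k = 6 then 1 else 0) {c : Fin 7 → ℂ}
    (hc : momentCross (moments t μ c) ≠ 0) (b : Fin 7 → ℂ) :
    ∃ (q : Fin 5 → ℂ) (l : Fin 3 → ℂ), ∀ i, ∑ k, q k * t i ^ (k : ℕ) +
      c i * ∑ j, l j * t i ^ (j : ℕ) = b i := by
  obtain ⟨l, h0, h1⟩ := exists_solution_of_momentCross_ne_zero hc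
    (∑ i, μ i * b i) (∑ i, μ i * t i * b i)
  obtain ⟨q, hq⟩ := exists_quartic_interpolation ht hμ
    (b := fun i => b i - c i * ∑ j, l j * t i ^ (j : ℕ))
    (by simp only [mul_sub, Finset.sum_sub_distrib, sum_weight_mul_quadratic, h0, sub_self])
    (by simp only [mul_sub, Finset.sum_sub_distrib, sum_weight_mul_node_mul_quadratic, h1, sub_self])
  exact ⟨q, l, fun i => by rw [hq i]; ring⟩

/-- For these moments `momentCross` is `(-1, 0, 0)`, a constant polynomial without zeros; this makes
the generic set nonempty. -/
theorem exists_moments_eq {t μ : Fin 7 → ℂ}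
    (hμ : ∀ k : Fin 7, ∑ i, μ i * t i ^ (k : ℕ) = if k = 6 then 1 else 0) :
    ∃ c, moments t μ c = ![0, 0, 1, 0] := by
  have h3 : ∑ i, μ i * t i ^ 3 = 0 := by simpa using hμ 3
  have h4 : ∑ i, μ i * t i ^ 4 = 0 := by simpa using hμ 4
  have h5 : ∑ i, μ i * t i ^ 5 = 0 := by simpa using hμ 5
  have h6 : ∑ i, μ i * t i ^ 6 = 1 := by simpa using hμ 6
  set σ := ∑ i, μ i * t i ^ 7 with hσ
  -- The values `t ^ 4` have moments `(0, 0, 1, σ)` and `t ^ 3` has `(0, 0, 0, 1)`.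
  refine ⟨fun i => t i ^ 4 - σ * t i ^ 3, ?_⟩
  have key : ∀ k : Fin 4, moments t μ (fun i => t i ^ 4 - σ * t i ^ 3) k =
      ∑ i, μ i * t i ^ (4 + k : ℕ) - σ * ∑ i, μ i * t i ^ (3 + k : ℕ) := fun k => by
    simp only [moments, Finset.mul_sum, ← Finset.sum_sub_distrib]
    exact Finset.sum_congr rfl fun i _ => by ring
  ext k
  rw [key]
  fin_cases k <;> simp [h3, h4, h5, h6, ← hσ]

end Interpolation

/-! ### Adapted frames and the parametrization of an irreducible conic -/

/-- Three independent vectors of a plane in four-space, completed to a basis of the whole space,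
together with the dual basis. -/
theorem exists_dual_frame {h : Fin 4 → ℂ} (hh : h ≠ 0) {e : Fin 3 → Fin 4 → ℂ}
    (he : LinearIndependent ℂ e) (hhe : ∀ j, h ⬝ᵥ e j = 0) :
    ∃ (f : Fin 4 → ℂ) (d : Fin 3 → Fin 4 → ℂ), h ⬝ᵥ f = 1 ∧
      (∀ j k, d j ⬝ᵥ e k = if j = k then 1 else 0) ∧
      ∀ x, h ⬝ᵥ x = 0 → x = ∑ j, (d j ⬝ᵥ x) • e j := by
  obtain ⟨i, hi⟩ := Function.ne_iff.mp hh
  have hi' : h i ≠ 0 := hi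
  set f : Fin 4 → ℂ := Pi.single i (h i)⁻¹
  have hf : h ⬝ᵥ f = 1 := by simp [f, hi']
  have hsp : ∀ x ∈ Submodule.span ℂ (Set.range e), h ⬝ᵥ x = 0 := fun x hx => by
    induction hx using Submodule.span_induction with
    | mem x hx => obtain ⟨j, rfl⟩ := hx; exact hhe j
    | zero => simp
    | add x y _ _ hx hy => rw [dotProduct_add, hx, hy, add_zero]
    | smul a x _ hx => rw [dotProduct_smul, hx, smul_zero]
  have hli : LinearIndependent ℂ (Fin.snoc e f : Fin 4 → Fin 4 → ℂ) :=
    linearIndependent_finSnoc.2 ⟨he, fun hm => by simpa [hf] using hsp f hm⟩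
  set M : Matrix (Fin 4) (Fin 4) ℂ := Matrix.of (Fin.snoc e f : Fin 4 → Fin 4 → ℂ) with hM
  have hu : IsUnit M := Matrix.linearIndependent_rows_iff_isUnit.1 hli
  have hdet : IsUnit M.det := (Matrix.isUnit_iff_isUnit_det _).1 hu
  have hMe : ∀ j : Fin 3, M j.castSucc = e j := fun j => by ext k; simp [hM]
  have hMf : M (Fin.last 3) = f := by
    rw [hM]
    exact Fin.snoc_last (α := fun _ => Fin 4 → ℂ) f e
  have hdual : ∀ (j k : Fin 4), (fun l => M⁻¹ l j) ⬝ᵥ M k = if k = j then 1 else 0 := fun j k => by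
    have := congrFun (congrFun (Matrix.mul_nonsing_inv _ hdet) k) j
    rw [Matrix.mul_apply, Matrix.one_apply] at this
    rw [← this, dotProduct_comm]
    rfl
  have hexp : ∀ x, x = ∑ j, ((fun l => M⁻¹ l j) ⬝ᵥ x) • M j := fun x => by
    have : x = x ᵥ* (M⁻¹ * M) := by rw [Matrix.nonsing_inv_mul _ hdet, Matrix.vecMul_one]
    rw [← Matrix.vecMul_vecMul] at this
    conv_lhs => rw [this, Matrix.vecMul_eq_sum]
    exact Finset.sum_congr rfl fun j _ => by
      rw [dotProduct_comm]
      rfl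
  refine ⟨f, fun j l => M⁻¹ l j.castSucc, hf, fun j k => ?_, fun x hx => ?_⟩
  · rw [← hMe k]
    simpa [eq_comm] using hdual j.castSucc k.castSucc
  · have h1 := hexp x
    rw [Fin.sum_univ_castSucc] at h1
    simp only [hMe, hMf] at h1
    have h2 : h ⬝ᵥ x = (fun l => M⁻¹ l (Fin.last 3)) ⬝ᵥ x := by
      conv_lhs => rw [h1]
      simp [dotProduct_add, dotProduct_sum, hhe, hf]
    rw [← h2, hx, zero_smul, add_zero] at h1
    exact h1

namespace PlaneConic

variable (β : PlaneConic)

theorem dotProduct_form_comm (x y : Fin 4 → ℂ) : x ⬝ᵥ β.form *ᵥ y = y ⬝ᵥ β.form *ᵥ x := by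
  rw [Matrix.dotProduct_mulVec, ← Matrix.mulVec_transpose, β.form_symm.eq, dotProduct_comm]

/-- A basis `e` of the plane of a conic in which the conic has the equation `x₁² = x₀ x₂`,
together with the dual basis `d` and a vector `f` outside the plane. -/
structure Frame where
  e : Fin 3 → Fin 4 → ℂ
  f : Fin 4 → ℂ
  d : Fin 3 → Fin 4 → ℂ
  scale : ℂ
  scale_ne_zero : scale ≠ 0
  normal_e : ∀ j, β.normal ⬝ᵥ e j = 0
  normal_f : β.normal ⬝ᵥ f = 1
  d_e : ∀ j k, d j ⬝ᵥ e k = if j = k then 1 else 0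
  expansion : ∀ x, β.normal ⬝ᵥ x = 0 → x = ∑ j, (d j ⬝ᵥ x) • e j
  form_eq : ∀ x, β.normal ⬝ᵥ x = 0 →
    x ⬝ᵥ β.form *ᵥ x = scale * ((d 1 ⬝ᵥ x) ^ 2 - (d 0 ⬝ᵥ x) * (d 2 ⬝ᵥ x))

variable {β}

theorem dotProduct_form_add (x y : Fin 4 → ℂ) (a b : ℂ) :
    (a • x + b • y) ⬝ᵥ β.form *ᵥ (a • x + b • y) =
      a ^ 2 * (x ⬝ᵥ β.form *ᵥ x) + 2 * a * b * (x ⬝ᵥ β.form *ᵥ y) +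
        b ^ 2 * (y ⬝ᵥ β.form *ᵥ y) := by
  simp only [Matrix.mulVec_add, Matrix.mulVec_smul, dotProduct_add, add_dotProduct,
    smul_dotProduct, dotProduct_smul, smul_eq_mul, β.dotProduct_form_comm y x]
  ring

/-- The plane of a conic is not contained in the span of two vectors. -/
theorem exists_third_vector (β : PlaneConic) (a b : Fin 4 → ℂ) :
    ∃ c, β.normal ⬝ᵥ c = 0 ∧ c ∉ Submodule.span ℂ {a, b} := by
  by_contra! hc
  let φ : (Fin 4 → ℂ) →ₗ[ℂ] ℂ :=
    { toFun := fun x => β.normal ⬝ᵥ x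
      map_add' := fun x y => dotProduct_add _ _ _
      map_smul' := fun r x => dotProduct_smul _ _ _ }
  have h1 : φ.ker ≤ Submodule.span ℂ {a, b} := fun x hx => hc x hx
  have h2 := Submodule.finrank_mono h1
  have h3 := φ.finrank_range_add_finrank_ker
  have h4 : Module.finrank ℂ φ.range ≤ 1 := by simpa using Submodule.finrank_le φ.range
  have h5 : Module.finrank ℂ (Submodule.span ℂ ({a, b} : Set (Fin 4 → ℂ))) ≤ 2 := by
    have hr : Set.range ![a, b] = {a, b} := by simp [Matrix.range_cons, Set.pair_comm]
    have h6 := finrank_range_le_card (R := ℂ) ![a, b]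
    rwa [Set.finrank, hr, Fintype.card_fin] at h6
  rw [Module.finrank_fin_fun] at h3
  omega

/-- A frame of an irreducible conic that starts and ends at given points of the conic. -/
theorem exists_frame (hβ : β.IsIrreducible) {a b : Fin 4 → ℂ}
    (hab : LinearIndependent ℂ ![a, b]) (ha : β.normal ⬝ᵥ a = 0) (hb : β.normal ⬝ᵥ b = 0)
    (hqa : a ⬝ᵥ β.form *ᵥ a = 0) (hqb : b ⬝ᵥ β.form *ᵥ b = 0) :
    ∃ (F : β.Frame) (r : ℂ), r ≠ 0 ∧ F.e 0 = a ∧ F.e 2 = r • b := by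
  obtain ⟨c₀, hc₀, hcs⟩ := β.exists_third_vector a b
  have hrange : Set.range ![a, b] = {a, b} := by simp [Matrix.range_cons, Set.pair_comm]
  have hli₀ : LinearIndependent ℂ ![c₀, a, b] :=
    linearIndependent_finCons.2 ⟨hab, by rwa [hrange]⟩
  obtain ⟨-, d₀, -, -, hexp₀⟩ := exists_dual_frame β.normal_ne_zero hli₀
    (fun j => by fin_cases j <;> simp [ha, hb, hc₀])
  simp only [Fin.sum_univ_three, Matrix.cons_val_zero, Matrix.cons_val_one, Matrix.cons_val] at hexp₀
  -- If `a` and `b` were conjugate, the form would be divisible by the coordinate `d₀ 0` along `c₀`.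
  have hB : a ⬝ᵥ β.form *ᵥ b ≠ 0 := fun hB => by
    refine hβ ⟨d₀ 0, (c₀ ⬝ᵥ β.form *ᵥ c₀) • d₀ 0 + (2 * (c₀ ⬝ᵥ β.form *ᵥ a)) • d₀ 1 +
      (2 * (c₀ ⬝ᵥ β.form *ᵥ b)) • d₀ 2, fun x hx => ?_⟩
    have h1 : x = (1 : ℂ) • ((d₀ 0 ⬝ᵥ x) • c₀ + (d₀ 1 ⬝ᵥ x) • a) + (d₀ 2 ⬝ᵥ x) • b := by
      rw [one_smul]; exact hexp₀ x hx
    have h2 : x ⬝ᵥ β.form *ᵥ x = (d₀ 0 ⬝ᵥ x) ^ 2 * (c₀ ⬝ᵥ β.form *ᵥ c₀) +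
        2 * (d₀ 0 ⬝ᵥ x) * (d₀ 1 ⬝ᵥ x) * (c₀ ⬝ᵥ β.form *ᵥ a) +
        2 * (d₀ 0 ⬝ᵥ x) * (d₀ 2 ⬝ᵥ x) * (c₀ ⬝ᵥ β.form *ᵥ b) := by
      conv_lhs => rw [h1]
      rw [dotProduct_form_add, dotProduct_form_add]
      simp only [add_dotProduct, smul_dotProduct, smul_eq_mul, hqa, hqb, hB]
      ring
    rw [h2]
    simp only [add_dotProduct, smul_dotProduct, smul_eq_mul]
    ring
  set m := a ⬝ᵥ β.form *ᵥ b with hm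
  -- Correction of `c₀` to a vector conjugate to both `a` and `b`, that is, the pole of the chord
  -- `ab`.
  set c : Fin 4 → ℂ := c₀ + (-(b ⬝ᵥ β.form *ᵥ c₀) / m) • a + (-(a ⬝ᵥ β.form *ᵥ c₀) / m) • b with hc
  have hnc : β.normal ⬝ᵥ c = 0 := by simp [hc, dotProduct_add, dotProduct_smul, ha, hb, hc₀]
  have hac : a ⬝ᵥ β.form *ᵥ c = 0 := by
    simp only [hc, Matrix.mulVec_add, Matrix.mulVec_smul, dotProduct_add, dotProduct_smul, hqa,
      ← hm, smul_eq_mul]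
    field_simp
    ring
  have hbc : b ⬝ᵥ β.form *ᵥ c = 0 := by
    simp only [hc, Matrix.mulVec_add, Matrix.mulVec_smul, dotProduct_add, dotProduct_smul, hqb,
      β.dotProduct_form_comm b a, ← hm, smul_eq_mul]
    field_simp
    ring
  have hcspan : c ∉ Submodule.span ℂ {a, b} := fun h => hcs (by
    have h1 : a ∈ Submodule.span ℂ {a, b} := Submodule.subset_span (by simp)
    have h2 : b ∈ Submodule.span ℂ {a, b} := Submodule.subset_span (by simp)
    have : c₀ = c - (-(b ⬝ᵥ β.form *ᵥ c₀) / m) • a - (-(a ⬝ᵥ β.form *ᵥ c₀) / m) • b := by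
      rw [hc]; abel
    rw [this]
    exact Submodule.sub_mem _ (Submodule.sub_mem _ h (Submodule.smul_mem _ _ h1))
      (Submodule.smul_mem _ _ h2))
  have hli : LinearIndependent ℂ ![c, a, b] :=
    linearIndependent_finCons.2 ⟨hab, by rwa [hrange]⟩
  obtain ⟨f, d, hf, hd, hexp⟩ := exists_dual_frame β.normal_ne_zero hli
    (fun j => by fin_cases j <;> simp [ha, hb, hnc])
  have hexp' := hexp
  simp only [Fin.sum_univ_three, Matrix.cons_val_zero, Matrix.cons_val_one, Matrix.cons_val] at hexp'
  set κ := c ⬝ᵥ β.form *ᵥ c with hκ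
  have hQ : ∀ x, β.normal ⬝ᵥ x = 0 → x ⬝ᵥ β.form *ᵥ x =
      (d 0 ⬝ᵥ x) ^ 2 * κ + 2 * (d 1 ⬝ᵥ x) * (d 2 ⬝ᵥ x) * m := fun x hx => by
    have h1 : x = (1 : ℂ) • ((d 0 ⬝ᵥ x) • c + (d 1 ⬝ᵥ x) • a) + (d 2 ⬝ᵥ x) • b := by
      rw [one_smul]; exact hexp' x hx
    conv_lhs => rw [h1]
    rw [dotProduct_form_add, dotProduct_form_add]
    simp only [add_dotProduct, smul_dotProduct, smul_eq_mul, hqa, hqb, β.dotProduct_form_comm c a,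
      β.dotProduct_form_comm c b, hac, hbc, ← hm, ← hκ]
    ring
  have hκ0 : κ ≠ 0 := fun h0 => hβ ⟨(2 * m) • d 1, d 2, fun x hx => by
    rw [hQ x hx, h0, smul_dotProduct, smul_eq_mul]
    ring⟩
  -- Scaling `b` by this factor turns `κ y² + 2 m x z` into `κ (y² - x z)`.
  have hr : -κ / (2 * m) ≠ 0 := by
    simp [hκ0, hB]
  refine ⟨{ e := ![a, c, (-κ / (2 * m)) • b], f := f, d := ![d 1, d 0, (-κ / (2 * m))⁻¹ • d 2],
            scale := κ, scale_ne_zero := hκ0, normal_e := ?_, normal_f := hf, d_e := ?_,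
            expansion := ?_, form_eq := ?_ }, -κ / (2 * m), hr, rfl, rfl⟩
  · intro j
    fin_cases j <;> simp [ha, hb, hnc]
  · have h00 := hd 0 0
    have h01 := hd 0 1
    have h02 := hd 0 2
    have h10 := hd 1 0
    have h11 := hd 1 1
    have h12 := hd 1 2
    have h20 := hd 2 0
    have h21 := hd 2 1
    have h22 := hd 2 2
    simp at h00 h01 h02 h10 h11 h12 h20 h21 h22
    intro j k
    generalize -κ / (2 * m) = r at *
    fin_cases j <;> fin_cases k <;>
      simp [smul_dotProduct, dotProduct_smul, h00, h01, h02, h10, h11, h12, h20, h21, h22, hr]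
  · intro x hx
    conv_lhs => rw [hexp' x hx]
    simp only [Fin.sum_univ_three, Matrix.cons_val_zero, Matrix.cons_val_one, Matrix.cons_val,
      smul_dotProduct, smul_eq_mul, smul_smul]
    rw [mul_right_comm, inv_mul_cancel₀ hr, one_mul]
    abel
  · intro x hx
    rw [hQ x hx]
    simp only [Matrix.cons_val_zero, Matrix.cons_val_one, Matrix.cons_val, smul_dotProduct,
      smul_eq_mul]
    field_simp
    ring

namespace Frame

variable (F : β.Frame)

/-- The parametrization of the conic that belongs to a frame; it omits only the point `e 2`. -/
def pt (t : ℂ) : Fin 4 → ℂ := F.e 0 + t • F.e 1 + t ^ 2 • F.e 2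

theorem normal_pt (t : ℂ) : β.normal ⬝ᵥ F.pt t = 0 := by
  simp [pt, dotProduct_add, dotProduct_smul, F.normal_e]

theorem d_pt (j : Fin 3) (t : ℂ) : F.d j ⬝ᵥ F.pt t = t ^ (j : ℕ) := by
  fin_cases j <;> simp [pt, dotProduct_add, dotProduct_smul, F.d_e]

theorem form_pt (t : ℂ) : F.pt t ⬝ᵥ β.form *ᵥ F.pt t = 0 := by
  rw [F.form_eq _ (F.normal_pt t), F.d_pt, F.d_pt, F.d_pt]
  simp

theorem pt_ne_zero (t : ℂ) : F.pt t ≠ 0 := fun h => by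
  simpa [h] using F.d_pt 0 t

/-- The pairing is a nonzero constant in `t`, so moving `p i` along `e 2` gives `c i` any prescribed
value. -/
theorem form_pt_e_two (t : ℂ) : 2 * (F.pt t ⬝ᵥ β.form *ᵥ F.e 2) = -F.scale := by
  have h1 := β.dotProduct_form_add (F.pt t) (F.e 2) 1 1
  have h2 : β.normal ⬝ᵥ F.e 2 = 0 := F.normal_e 2
  rw [one_smul, one_smul, F.form_eq (F.pt t + F.e 2) (by
    rw [dotProduct_add, h2, F.normal_pt, add_zero]), F.form_pt, F.form_eq _ h2] at h1
  simp only [dotProduct_add, F.d_pt, F.d_e] at h1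
  simp at h1
  linear_combination -h1

theorem exists_eq_smul_pt {x : Fin 4 → ℂ} (hx : β.normal ⬝ᵥ x = 0) (hq : x ⬝ᵥ β.form *ᵥ x = 0) :
    x = (F.d 2 ⬝ᵥ x) • F.e 2 ∨ F.d 0 ⬝ᵥ x ≠ 0 ∧ ∃ t, x = (F.d 0 ⬝ᵥ x) • F.pt t := by
  rw [F.form_eq x hx, mul_eq_zero, or_iff_right F.scale_ne_zero] at hq
  have h := F.expansion x hx
  rw [Fin.sum_univ_three] at h
  by_cases h0 : F.d 0 ⬝ᵥ x = 0
  · left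
    have h1 : F.d 1 ⬝ᵥ x = 0 := by simpa [h0] using hq
    rwa [h0, h1, zero_smul, zero_smul, zero_add, zero_add] at h
  · refine Or.inr ⟨h0, (F.d 1 ⬝ᵥ x) / (F.d 0 ⬝ᵥ x), ?_⟩
    have h2 : F.d 2 ⬝ᵥ x = (F.d 0 ⬝ᵥ x) * ((F.d 1 ⬝ᵥ x) / (F.d 0 ⬝ᵥ x)) ^ 2 := by
      field_simp
      linear_combination -hq
    have h1 : F.d 1 ⬝ᵥ x = (F.d 0 ⬝ᵥ x) * ((F.d 1 ⬝ᵥ x) / (F.d 0 ⬝ᵥ x)) := by field_simp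
    generalize (F.d 1 ⬝ᵥ x) / (F.d 0 ⬝ᵥ x) = t at h1 h2 ⊢
    rw [pt, smul_add, smul_add, smul_smul, smul_smul, ← h1, ← h2]
    exact h

end Frame

end PlaneConic

/-! ### Perturbation of the conic and the implicit function theorem -/

/-- A regular zero set contains a curve in every direction of the kernel of the derivative. -/
theorem exists_curve_of_hasStrictFDerivAt {E G : Type*} [NormedAddCommGroup E] [NormedSpace ℂ E]
    [CompleteSpace E] [NormedAddCommGroup G] [NormedSpace ℂ G] [FiniteDimensional ℂ G]
    {F : E → G} {F' : E →L[ℂ] G} (hF : HasStrictFDerivAt F F' 0) (h0 : F 0 = 0)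
    (hs : Function.Surjective F') {k : E} (hk : F' k = 0) :
    ∃ γ : ℂ → E, γ 0 = 0 ∧ HasDerivAt γ k 0 ∧ ∀ᶠ τ in 𝓝 0, F (γ τ) = 0 := by
  have hr : F'.range = ⊤ := LinearMap.range_eq_top.2 hs
  let k' : F'.ker := ⟨k, hk⟩
  refine ⟨fun τ => hF.implicitFunction F F' hr (F 0) (τ • k'), ?_, ?_, ?_⟩
  · simp only [zero_smul, HasStrictFDerivAt.implicitFunction_apply_image]
  · have h1 : HasFDerivAt (hF.implicitFunction F F' hr (F 0)) F'.ker.subtypeL ((0 : ℂ) • k') := by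
      rw [zero_smul]
      exact (hF.to_implicitFunction hr).hasFDerivAt
    have h2 : HasDerivAt (fun τ : ℂ => τ • k') k' 0 := by
      simpa using (hasDerivAt_id (0 : ℂ)).smul_const k'
    simpa [k', Function.comp_def] using h1.comp_hasDerivAt (0 : ℂ) h2
  · have h1 := hF.map_implicitFunction_eq hr
    have h2 : Tendsto (fun τ : ℂ => (F 0, τ • k')) (𝓝 0) (𝓝 (F 0, 0)) := by
      have : Continuous fun τ : ℂ => (F 0, τ • k') := by fun_prop
      simpa using this.tendsto 0
    filter_upwards [h2.eventually h1] with τ hτ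
    rw [← h0]
    exact hτ

theorem continuous_planeSection : Continuous planeSection := by
  refine continuous_matrix fun i j => ?_
  fin_cases i <;> fin_cases j <;> simp [planeSection] <;> fun_prop

/-- The symmetric matrix of the quadratic form `x ↦ (a ⬝ᵥ x) * (b ⬝ᵥ x)`. -/
noncomputable def symProd (a b : Fin 4 → ℂ) : Matrix (Fin 4) (Fin 4) ℂ :=
  (1 / 2 : ℂ) • (Matrix.vecMulVec a b + Matrix.vecMulVec b a)

theorem symProd_isSymm (a b : Fin 4 → ℂ) : (symProd a b).IsSymm := by
  rw [Matrix.IsSymm, symProd, Matrix.transpose_smul, Matrix.transpose_add,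
    Matrix.transpose_vecMulVec, Matrix.transpose_vecMulVec, add_comm]

theorem dotProduct_symProd (a b x : Fin 4 → ℂ) :
    x ⬝ᵥ symProd a b *ᵥ x = (a ⬝ᵥ x) * (b ⬝ᵥ x) := by
  rw [dotProduct_comm]
  simp only [symProd, Matrix.smul_mulVec, Matrix.add_mulVec, Matrix.vecMulVec_mulVec,
    smul_dotProduct, add_dotProduct, op_smul_eq_smul, smul_eq_mul]
  ring

namespace PlaneConic

variable {β : PlaneConic}

/-- The Chow matrix is polynomial in the normal vector and the form, and its class in `P20` defines
the topology. -/
theorem tendsto_of_tendsto_normal_form {βs : ℕ → PlaneConic}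
    (hn : Tendsto (fun n => (βs n).normal) atTop (𝓝 β.normal))
    (hf : Tendsto (fun n => (βs n).form) atTop (𝓝 β.form)) : Tendsto βs atTop (𝓝 β) := by
  have hmk : Continuous (Projectivization.mk' ℂ : {v : symMatrices // v ≠ 0} → P20) :=
    continuous_coinduced_rng
  have hS : Continuous fun q : (Fin 4 → ℂ) × Matrix (Fin 4) (Fin 4) ℂ => planeSection q.1 :=
    continuous_planeSection.comp continuous_fst
  have hchow : Continuous fun q : (Fin 4 → ℂ) × Matrix (Fin 4) (Fin 4) ℂ =>
      (planeSection q.1)ᵀ * q.2 * planeSection q.1 :=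
    (hS.matrix_transpose.matrix_mul continuous_snd).matrix_mul hS
  have hlim : Tendsto (fun n => (βs n).chowMatrix) atTop (𝓝 β.chowMatrix) :=
    Tendsto.comp (g := fun q : (Fin 4 → ℂ) × Matrix (Fin 4) (Fin 4) ℂ =>
      (planeSection q.1)ᵀ * q.2 * planeSection q.1) (f := fun n => ((βs n).normal, (βs n).form))
      (hchow.tendsto (β.normal, β.form)) (hn.prodMk_nhds hf)
  rw [nhds_induced, tendsto_comap_iff]
  refine (hmk.tendsto ⟨⟨β.chowMatrix, β.chowMatrix_symm⟩, _⟩).comp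
    (f := fun n => ⟨⟨(βs n).chowMatrix, (βs n).chowMatrix_symm⟩, fun h =>
      (βs n).chowMatrix_ne_zero (congrArg Subtype.val h)⟩) ?_
  exact tendsto_subtype_rng.2 (tendsto_subtype_rng.2 hlim)

namespace Frame

variable (F : β.Frame)

/-- The quadratic forms that restrict to the monomials of degree at most four in the parameter. -/
noncomputable def quartic : Fin 5 → Matrix (Fin 4) (Fin 4) ℂ :=
  ![symProd (F.d 0) (F.d 0), symProd (F.d 0) (F.d 1), symProd (F.d 1) (F.d 1),
    symProd (F.d 1) (F.d 2), symProd (F.d 2) (F.d 2)]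

theorem quartic_isSymm (k : Fin 5) : (F.quartic k).IsSymm := by
  fin_cases k <;> exact symProd_isSymm _ _

theorem quartic_pt (k : Fin 5) (t : ℂ) : F.pt t ⬝ᵥ F.quartic k *ᵥ F.pt t = t ^ (k : ℕ) := by
  fin_cases k <;> simp [quartic, dotProduct_symProd, d_pt] <;> ring

/-- The normal vector of a perturbed conic. -/
def normalAt (v : (Fin 5 → ℂ) × (Fin 3 → ℂ)) : Fin 4 → ℂ := β.normal + ∑ j, v.2 j • F.d j

/-- The matrix of a perturbed conic. -/
noncomputable def formAt (v : (Fin 5 → ℂ) × (Fin 3 → ℂ)) : Matrix (Fin 4) (Fin 4) ℂ :=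
  β.form + ∑ k, v.1 k • F.quartic k

theorem continuous_normalAt : Continuous F.normalAt := by
  unfold normalAt
  fun_prop

theorem continuous_formAt : Continuous F.formAt := by
  unfold formAt
  fun_prop

theorem formAt_isSymm (v : (Fin 5 → ℂ) × (Fin 3 → ℂ)) : (F.formAt v).IsSymm := by
  rw [Matrix.IsSymm, formAt, Matrix.transpose_add, β.form_symm.eq, Matrix.transpose_sum]
  simp only [Matrix.transpose_smul, (F.quartic_isSymm _).eq]

@[simp] theorem normalAt_zero : F.normalAt 0 = β.normal := by simp [normalAt]

@[simp] theorem formAt_zero : F.formAt 0 = β.form := by simp [formAt]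

theorem normalAt_dotProduct (v : (Fin 5 → ℂ) × (Fin 3 → ℂ)) (x : Fin 4 → ℂ) :
    F.normalAt v ⬝ᵥ x = β.normal ⬝ᵥ x + ∑ j, v.2 j * (F.d j ⬝ᵥ x) := by
  simp [normalAt, add_dotProduct, sum_dotProduct]

theorem dotProduct_formAt (v : (Fin 5 → ℂ) × (Fin 3 → ℂ)) (x y : Fin 4 → ℂ) :
    x ⬝ᵥ F.formAt v *ᵥ y = x ⬝ᵥ β.form *ᵥ y + ∑ k, v.1 k * (x ⬝ᵥ F.quartic k *ᵥ y) := by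
  simp [formAt, Matrix.add_mulVec, Matrix.sum_mulVec, dotProduct_sum, Matrix.smul_mulVec]

theorem eventually_isConic : ∀ᶠ v in 𝓝 (0 : (Fin 5 → ℂ) × (Fin 3 → ℂ)),
    F.normalAt v ≠ 0 ∧ ∃ y, F.normalAt v ⬝ᵥ y = 0 ∧ y ⬝ᵥ F.formAt v *ᵥ y ≠ 0 := by
  obtain ⟨y₀, hy₀, hq₀⟩ := β.form_nonzero
  -- Up to scale, the projection of `y₀` along `F.f` to the perturbed plane; at `v = 0` it is `y₀`
  -- itself.
  let y : (Fin 5 → ℂ) × (Fin 3 → ℂ) → Fin 4 → ℂ := fun v =>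
    (F.normalAt v ⬝ᵥ F.f) • y₀ - (F.normalAt v ⬝ᵥ y₀) • F.f
  have hy : Continuous y := by
    have := F.continuous_normalAt
    exact ((this.dotProduct continuous_const).smul continuous_const).sub
      ((this.dotProduct continuous_const).smul continuous_const)
  have hq : Continuous fun v => y v ⬝ᵥ F.formAt v *ᵥ y v :=
    hy.dotProduct (F.continuous_formAt.matrix_mulVec hy)
  have h1 : ∀ᶠ v in 𝓝 0, F.normalAt v ≠ 0 :=
    F.continuous_normalAt.continuousAt.eventually_ne (by simpa using β.normal_ne_zero)
  have h2 : ∀ᶠ v in 𝓝 0, y v ⬝ᵥ F.formAt v *ᵥ y v ≠ 0 :=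
    hq.continuousAt.eventually_ne (by simpa [y, hy₀, F.normal_f] using hq₀)
  filter_upwards [h1, h2] with v hv1 hv2
  refine ⟨hv1, y v, ?_, hv2⟩
  simp only [y, dotProduct_sub, dotProduct_smul, smul_eq_mul]
  ring

/-- The point in which the line through `x` and `p` meets the perturbed plane. -/
def pointAt (x p : Fin 4 → ℂ) (v : (Fin 5 → ℂ) × (Fin 3 → ℂ)) : Fin 4 → ℂ :=
  (F.normalAt v ⬝ᵥ x) • p - (F.normalAt v ⬝ᵥ p) • x

theorem normalAt_pointAt (x p : Fin 4 → ℂ) (v : (Fin 5 → ℂ) × (Fin 3 → ℂ)) :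
    F.normalAt v ⬝ᵥ F.pointAt x p v = 0 := by
  simp only [pointAt, dotProduct_sub, dotProduct_smul, smul_eq_mul]
  ring

theorem continuous_pointAt (x p : Fin 4 → ℂ) : Continuous (F.pointAt x p) := by
  have := F.continuous_normalAt
  exact ((this.dotProduct continuous_const).smul continuous_const).sub
      ((this.dotProduct continuous_const).smul continuous_const)

/-- The linear form with coefficients `a` in the perturbation of the quadratic form. -/
noncomputable def linFst (a : Fin 5 → ℂ) : (Fin 5 → ℂ) × (Fin 3 → ℂ) →L[ℂ] ℂ :=
  ∑ k, a k • (ContinuousLinearMap.proj k ∘L ContinuousLinearMap.fst ℂ _ _)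

/-- The linear form with coefficients `a` in the perturbation of the plane. -/
noncomputable def linSnd (a : Fin 3 → ℂ) : (Fin 5 → ℂ) × (Fin 3 → ℂ) →L[ℂ] ℂ :=
  ∑ k, a k • (ContinuousLinearMap.proj k ∘L ContinuousLinearMap.snd ℂ _ _)

theorem linFst_apply (a : Fin 5 → ℂ) (v : (Fin 5 → ℂ) × (Fin 3 → ℂ)) :
    linFst a v = ∑ k, v.1 k * a k := by
  simp [linFst, mul_comm]

theorem linSnd_apply (a : Fin 3 → ℂ) (v : (Fin 5 → ℂ) × (Fin 3 → ℂ)) :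
    linSnd a v = ∑ k, v.2 k * a k := by
  simp [linSnd, mul_comm]

/-- The condition that the perturbed conic meets the line through `F.pt t` and `p`, to first
order. -/
theorem hasStrictFDerivAt_pointAt (t : ℂ) {p : Fin 4 → ℂ} (hp : β.normal ⬝ᵥ p = 1) :
    HasStrictFDerivAt (fun v => F.pointAt (F.pt t) p v ⬝ᵥ F.formAt v *ᵥ F.pointAt (F.pt t) p v)
      (linFst (fun k => t ^ (k : ℕ)) +
        (-2 * (F.pt t ⬝ᵥ β.form *ᵥ p)) • linSnd (fun j => t ^ (j : ℕ))) 0 := by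
  set b := F.pt t ⬝ᵥ β.form *ᵥ p with hb
  set a := p ⬝ᵥ β.form *ᵥ p with ha
  set lam := linSnd (fun j => t ^ (j : ℕ)) with hlam
  set π := linFst (fun k => t ^ (k : ℕ)) with hπ
  set m := linSnd (fun j => F.d j ⬝ᵥ p) with hm
  set ρ := linFst (fun k => F.pt t ⬝ᵥ F.quartic k *ᵥ p) with hρ
  set σ := linFst (fun k => p ⬝ᵥ F.quartic k *ᵥ p) with hσ
  -- Both `lam` and `π` vanish at 0, so the linear part is `π - 2 * b * lam`.
  have key : ∀ v, F.pointAt (F.pt t) p v ⬝ᵥ F.formAt v *ᵥ F.pointAt (F.pt t) p v =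
      lam v * lam v * (a + σ v) - 2 * lam v * (1 + m v) * (b + ρ v) +
        (1 + m v) * (1 + m v) * π v := fun v => by
    have e1 : F.normalAt v ⬝ᵥ F.pt t = lam v := by
      rw [normalAt_dotProduct, F.normal_pt, zero_add, hlam, linSnd_apply]
      simp only [F.d_pt]
    have e2 : F.normalAt v ⬝ᵥ p = 1 + m v := by
      rw [normalAt_dotProduct, hp, hm, linSnd_apply]
    have e3 : F.pt t ⬝ᵥ F.formAt v *ᵥ F.pt t = π v := by
      rw [dotProduct_formAt, F.form_pt, zero_add, hπ, linFst_apply]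
      simp only [F.quartic_pt]
    have e4 : F.pt t ⬝ᵥ F.formAt v *ᵥ p = b + ρ v := by
      rw [dotProduct_formAt, hρ, linFst_apply]
    have e5 : p ⬝ᵥ F.formAt v *ᵥ p = a + σ v := by
      rw [dotProduct_formAt, hσ, linFst_apply]
    have e6 : p ⬝ᵥ F.formAt v *ᵥ F.pt t = b + ρ v := by
      rw [← e4, Matrix.dotProduct_mulVec, ← Matrix.mulVec_transpose, (F.formAt_isSymm v).eq,
        dotProduct_comm]
    simp only [pointAt, e1, e2, Matrix.mulVec_sub, Matrix.mulVec_smul, dotProduct_sub,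
      sub_dotProduct, smul_dotProduct, dotProduct_smul, smul_eq_mul, e3, e4, e5, e6]
    ring
  simp_rw [key]
  have dl := lam.hasStrictFDerivAt (x := 0)
  have dm := (m.hasStrictFDerivAt (x := 0)).const_add 1
  have dr := (ρ.hasStrictFDerivAt (x := 0)).const_add b
  have ds := (σ.hasStrictFDerivAt (x := 0)).const_add a
  have dp := π.hasStrictFDerivAt (x := 0)
  refine ((((dl.mul dl).mul ds).sub (((dl.const_mul 2).mul dm).mul dr)).add
    ((dm.mul dm).mul dp)).congr_fderiv ?_
  ext v <;> simp <;> ring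

/-- If the linearized incidence conditions are regular and have a solution that moves the plane
away from all the points `F.pt (t i)`, then the conic is a limit of conics that meet the lines
joining `F.pt (t i)` and `p i` but do not contain these points. -/
theorem exists_tendsto {ι : Type*} [Finite ι] [Nonempty ι] (t : ι → ℂ) (p : ι → Fin 4 → ℂ)
    (hp : ∀ i, β.normal ⬝ᵥ p i = 1) {c : ι → ℂ}
    (hc : ∀ i, c i = -2 * (F.pt (t i) ⬝ᵥ β.form *ᵥ p i))
    (hsurj : ∀ b : ι → ℂ, ∃ (q : Fin 5 → ℂ) (l : Fin 3 → ℂ),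
      ∀ i, ∑ k, q k * t i ^ (k : ℕ) + c i * ∑ j, l j * t i ^ (j : ℕ) = b i)
    {q : Fin 5 → ℂ} {l : Fin 3 → ℂ}
    (hker : ∀ i, ∑ k, q k * t i ^ (k : ℕ) + c i * ∑ j, l j * t i ^ (j : ℕ) = 0)
    (hl : ∀ i, ∑ j, l j * t i ^ (j : ℕ) ≠ 0) :
    ∃ βs : ℕ → PlaneConic, Tendsto βs atTop (𝓝 β) ∧ ∀ n i,
      (∃ y ∈ Submodule.span ℂ {F.pt (t i), p i}, y ≠ 0 ∧ (βs n).normal ⬝ᵥ y = 0 ∧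
        y ⬝ᵥ (βs n).form *ᵥ y = 0) ∧ (βs n).normal ⬝ᵥ F.pt (t i) ≠ 0 := by
  have := Fintype.ofFinite ι
  let G : (Fin 5 → ℂ) × (Fin 3 → ℂ) → ι → ℂ := fun v i =>
    F.pointAt (F.pt (t i)) (p i) v ⬝ᵥ F.formAt v *ᵥ F.pointAt (F.pt (t i)) (p i) v
  let G' : (Fin 5 → ℂ) × (Fin 3 → ℂ) →L[ℂ] ι → ℂ := ContinuousLinearMap.pi fun i =>
    linFst (fun k => t i ^ (k : ℕ)) +
        (-2 * (F.pt (t i) ⬝ᵥ β.form *ᵥ p i)) • linSnd (fun j => t i ^ (j : ℕ))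
  have hG : HasStrictFDerivAt G G' 0 :=
    hasStrictFDerivAt_pi.2 fun i => F.hasStrictFDerivAt_pointAt (t i) (hp i)
  have hG' : ∀ v i, G' v i =
      ∑ k, v.1 k * t i ^ (k : ℕ) + c i * ∑ j, v.2 j * t i ^ (j : ℕ) := fun v i => by
    simp [G', linFst_apply, linSnd_apply, hc]
  have hpt0 : ∀ i, F.pointAt (F.pt (t i)) (p i) 0 = -F.pt (t i) := fun i => by
    simp [pointAt, F.normal_pt, hp]
  have hG0 : G 0 = 0 := by
    ext i
    simp [G, hpt0, F.form_pt, Matrix.mulVec_neg]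
  obtain ⟨γ, hγ0, hγ, hGγ⟩ := exists_curve_of_hasStrictFDerivAt hG hG0
    (fun b => by
      obtain ⟨q, l, h⟩ := hsurj b
      exact ⟨(q, l), funext fun i => by rw [hG', h i]⟩)
    (k := (q, l)) (funext fun i => by rw [hG']; exact hker i)
  have hγt : Tendsto γ (𝓝[≠] 0) (𝓝 0) := by
    have := hγ.continuousAt.tendsto
    rw [hγ0] at this
    exact this.mono_left nhdsWithin_le_nhds
  -- The value of the moving plane's equation at `F.pt (t i)` has derivative `l (t i) ≠ 0` at `τ =
  -- 0`, hence is nonzero for small `τ ≠ 0`.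
  have hne : ∀ i, ∀ᶠ τ in 𝓝[≠] 0, F.normalAt (γ τ) ⬝ᵥ F.pt (t i) ≠ 0 := fun i => by
    have hd : HasDerivAt (fun τ => linSnd (fun j => t i ^ (j : ℕ)) (γ τ))
        (linSnd (fun j => t i ^ (j : ℕ)) (q, l)) 0 :=
      (linSnd (fun j => t i ^ (j : ℕ))).hasFDerivAt.comp_hasDerivAt (0 : ℂ) hγ
    have hne := hd.eventually_ne (c := 0) (by rw [linSnd_apply]; exact hl i)
    filter_upwards [hne] with τ hτ
    rw [normalAt_dotProduct, F.normal_pt, zero_add]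
    simpa only [linSnd_apply, F.d_pt] using hτ
  have hpt : ∀ i, ∀ᶠ τ in 𝓝[≠] 0, F.pointAt (F.pt (t i)) (p i) (γ τ) ≠ 0 := fun i =>
    hγt.eventually ((F.continuous_pointAt _ _).continuousAt.eventually_ne
      (by simpa [hpt0] using F.pt_ne_zero (t i)))
  have hall : ∀ᶠ τ in 𝓝[≠] 0, (F.normalAt (γ τ) ≠ 0 ∧
      ∃ y, F.normalAt (γ τ) ⬝ᵥ y = 0 ∧ y ⬝ᵥ F.formAt (γ τ) *ᵥ y ≠ 0) ∧ G (γ τ) = 0 ∧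
      (∀ i, F.normalAt (γ τ) ⬝ᵥ F.pt (t i) ≠ 0) ∧
      ∀ i, F.pointAt (F.pt (t i)) (p i) (γ τ) ≠ 0 :=
    (hγt.eventually F.eventually_isConic).and <|
      (hGγ.filter_mono nhdsWithin_le_nhds).and <| (eventually_all.2 hne).and (eventually_all.2 hpt)
  obtain ⟨u, hu, hgood⟩ := exists_seq_forall_of_frequently
    (l := 𝓝[≠] (0 : ℂ)) hall.frequently
  refine ⟨fun n => ⟨F.normalAt (γ (u n)), F.formAt (γ (u n)), (hgood n).1.1,
    F.formAt_isSymm _, (hgood n).1.2⟩, tendsto_of_tendsto_normal_form ?_ ?_, fun n i => ⟨?_, ?_⟩⟩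
  · simpa [Function.comp_def] using (F.continuous_normalAt.tendsto 0).comp (hγt.comp hu)
  · simpa [Function.comp_def] using (F.continuous_formAt.tendsto 0).comp (hγt.comp hu)
  · refine ⟨F.pointAt (F.pt (t i)) (p i) (γ (u n)), ?_, (hgood n).2.2.2 i,
      F.normalAt_pointAt _ _ _, congrFun (hgood n).2.1 i⟩
    exact Submodule.sub_mem _
      (Submodule.smul_mem _ _ (Submodule.subset_span (by simp)))
      (Submodule.smul_mem _ _ (Submodule.subset_span (by simp)))
  · exact (hgood n).2.2.1 i

end Frame

end PlaneConic

/-! ### Genericity as a polynomial condition in Plücker coordinates -/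

theorem map_momentCross {R S : Type*} [CommRing R] [CommRing S] (φ : R →+* S) (s : Fin 4 → R)
    (j : Fin 3) : φ (momentCross s j) = momentCross (fun k => φ (s k)) j := by
  fin_cases j <;> simp [momentCross]

theorem moments_smul (t μ c : Fin 7 → ℂ) (r : ℂ) :
    moments t μ (fun i => r * c i) = fun k => r * moments t μ c k := by
  ext k
  simp only [moments, Finset.mul_sum]
  exact Finset.sum_congr rfl fun _ _ => by ring

theorem momentCross_smul {R : Type*} [CommRing R] (s : Fin 4 → R) (r : R) (j : Fin 3) :
    momentCross (fun k => r * s k) j = r ^ 2 * momentCross s j := by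
  fin_cases j <;> simp [momentCross] <;> ring

/-- The linear form with coefficients `a` in the `i`-th group of six variables. -/
noncomputable def linPoly (i : Fin 7) (a : Fin 6 → ℂ) : MvPolynomial (Fin 7 × Fin 6) ℂ :=
  ∑ k, MvPolynomial.C (a k) * MvPolynomial.X (i, k)

theorem eval_linPoly (i : Fin 7) (a : Fin 6 → ℂ) (P : Fin 7 → Fin 6 → ℂ) :
    MvPolynomial.eval (fun k : Fin 7 × Fin 6 => P k.1 k.2) (linPoly i a) = a ⬝ᵥ P i := by
  simp [linPoly, dotProduct]

/-- Nonvanishing of the solution of the two moment equations at all nodes, for coefficients that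
are quotients of linear forms, is nonvanishing of a polynomial. -/
theorem exists_genericity_polynomial (t μ : Fin 7 → ℂ) (a : Fin 6 → ℂ) (g : Fin 7 → Fin 6 → ℂ) :
    ∃ f : MvPolynomial (Fin 7 × Fin 6) ℂ, ∀ P : Fin 7 → Fin 6 → ℂ,
      MvPolynomial.eval (fun k : Fin 7 × Fin 6 => P k.1 k.2) f ≠ 0 ↔
        (∀ i, a ⬝ᵥ P i ≠ 0) ∧ ∀ i, ∑ j : Fin 3,
          momentCross (moments t μ fun i => -2 * (g i ⬝ᵥ P i / a ⬝ᵥ P i)) j * t i ^ (j : ℕ) ≠ 0 := by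
  -- Denominators are cleared by the full product of the `a ⬝ᵥ P j`; this rescales all coefficients
  -- by a common factor `r` and `momentCross` by `r ^ 2`.
  let c : Fin 7 → MvPolynomial (Fin 7 × Fin 6) ℂ := fun i =>
    linPoly i (g i) * ∏ j ∈ Finset.univ.erase i, linPoly j a
  let s : Fin 4 → MvPolynomial (Fin 7 × Fin 6) ℂ := fun k =>
    ∑ i, MvPolynomial.C (μ i) * c i * MvPolynomial.C (t i) ^ (k : ℕ)
  refine ⟨(∏ i, linPoly i a) * ∏ i, ∑ j : Fin 3, momentCross s j * MvPolynomial.C (t i) ^ (j : ℕ),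
    fun P => ?_⟩
  set ev := MvPolynomial.eval (fun k : Fin 7 × Fin 6 => P k.1 k.2) with hev
  rw [map_mul, mul_ne_zero_iff, map_prod, map_prod, Finset.prod_ne_zero_iff,
    Finset.prod_ne_zero_iff]
  simp only [Finset.mem_univ, true_implies, hev, eval_linPoly]
  refine and_congr_right fun ha => forall_congr' fun i => ?_
  set r := -(∏ j, a ⬝ᵥ P j) / 2 with hr
  have hr0 : r ≠ 0 :=
    div_ne_zero (neg_ne_zero.2 (Finset.prod_ne_zero_iff.2 fun j _ => ha j)) two_ne_zero
  have hc : ∀ i, ev (c i) = r * (-2 * (g i ⬝ᵥ P i / a ⬝ᵥ P i)) := fun i => by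
    have h1 := Finset.mul_prod_erase Finset.univ (fun j => a ⬝ᵥ P j) (Finset.mem_univ i)
    simp only [c, map_mul, map_prod, hev, eval_linPoly]
    rw [hr, ← h1]
    have := ha i
    field_simp
  have hs : (fun k => ev (s k)) =
      fun k => r * moments t μ (fun i => -2 * (g i ⬝ᵥ P i / a ⬝ᵥ P i)) k := by
    rw [← moments_smul]
    ext k
    simp only [s, moments, map_sum, map_mul, map_pow, hc]
    simp only [hev, MvPolynomial.eval_C]
  have hsum : ev (∑ j : Fin 3, momentCross s j * MvPolynomial.C (t i) ^ (j : ℕ)) =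
      r ^ 2 * ∑ j : Fin 3,
        momentCross (moments t μ fun i => -2 * (g i ⬝ᵥ P i / a ⬝ᵥ P i)) j * t i ^ (j : ℕ) := by
    simp only [map_sum, map_mul, map_pow, map_momentCross, hs, momentCross_smul, Finset.mul_sum]
    exact Finset.sum_congr rfl fun j _ => by simp only [hev, MvPolynomial.eval_C]; ring
  rw [← hev, hsum, mul_ne_zero_iff, and_iff_right (pow_ne_zero 2 hr0)]

/-- With `h` the normal vector or `β.form *ᵥ F.pt (t i)`, and `d = F.d 0`, these linear forms are
the denominator and numerator of `c i`, up to the factor `-2`. -/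
theorem dotProduct_vecMul_planeSection_plucker (d h u v : Fin 4 → ℂ) :
    (d ᵥ* planeSection h) ⬝ᵥ plucker u v = (h ⬝ᵥ u) * (d ⬝ᵥ v) - (h ⬝ᵥ v) * (d ⬝ᵥ u) := by
  rw [← Matrix.dotProduct_mulVec, planeSection_mulVec_plucker, dotProduct_sub, dotProduct_smul,
    dotProduct_smul, smul_eq_mul, smul_eq_mul]

/-! ### Placing the given points in one affine chart of the conic -/

namespace PlaneConic

variable {β : PlaneConic}

theorem mk_mem_points {y : Fin 4 → ℂ} (hy : y ≠ 0) (hn : β.normal ⬝ᵥ y = 0)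
    (hq : y ⬝ᵥ β.form *ᵥ y = 0) : Projectivization.mk ℂ y hy ∈ β.points := by
  intro x hx
  rw [Projectivization.submodule_mk, Submodule.mem_span_singleton] at hx
  obtain ⟨r, rfl⟩ := hx
  simp [dotProduct_smul, smul_dotProduct, Matrix.mulVec_smul, hn, hq]

theorem rep_mem_submodule (X : P3) : X.rep ∈ X.submodule := by
  rw [X.submodule_eq]
  exact Submodule.mem_span_singleton_self _

theorem exists_frame_of_mem_points (hβ : β.IsIrreducible) {X Y : P3} (hX : X ∈ β.points)
    (hY : Y ∈ β.points) (hXY : X ≠ Y) : ∃ (F : β.Frame) (r : ℂ), r ≠ 0 ∧ F.e 2 = r • Y.rep := by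
  have hli : LinearIndependent ℂ ![X.rep, Y.rep] := by
    have h := Projectivization.independent_iff.1 ((Projectivization.independent_pair_iff_ne X Y).2 hXY)
    have hrep : ![X.rep, Y.rep] = Projectivization.rep ∘ ![X, Y] := by
      funext i
      fin_cases i <;> rfl
    rw [hrep]
    exact h
  obtain ⟨hX1, hX2⟩ := hX _ (rep_mem_submodule X)
  obtain ⟨hY1, hY2⟩ := hY _ (rep_mem_submodule Y)
  obtain ⟨F, r, hr, -, h2⟩ := exists_frame hβ hli hX1 hY1 hX2 hY2
  exact ⟨F, r, hr, h2⟩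

theorem Frame.mk_pt_injective (F : β.Frame) :
    Function.Injective fun t => Projectivization.mk ℂ (F.pt t) (F.pt_ne_zero t) := by
  intro s t hst
  obtain ⟨a, ha⟩ := (Projectivization.mk_eq_mk_iff' ℂ _ _ _ _).1 hst
  have h0 := congrArg (F.d 0 ⬝ᵥ ·) ha
  have h1 := congrArg (F.d 1 ⬝ᵥ ·) ha
  simp only [dotProduct_smul, F.d_pt] at h0 h1
  simp at h0 h1
  rw [← h1, h0, one_mul]

/-- Distinct points on an irreducible conic lie in the affine part of some parametrization. -/
theorem exists_frame_mk_pt {ι : Type*} [Finite ι] [Nontrivial ι] (hβ : β.IsIrreducible)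
    {X : ι → P3} (hX : Function.Injective X) (hXβ : ∀ i, X i ∈ β.points) :
    ∃ (F : β.Frame) (t : ι → ℂ), Function.Injective t ∧
      ∀ i, X i = Projectivization.mk ℂ (F.pt (t i)) (F.pt_ne_zero (t i)) := by
  obtain ⟨i₀, i₁, h01⟩ := exists_pair_ne ι
  obtain ⟨F₀, -, -, -⟩ := exists_frame_of_mem_points hβ (hXβ i₀) (hXβ i₁) (hX.ne h01)
  -- The first frame only shows that the conic has infinitely many points. A point `Y` other than
  -- all `X i` becomes the omitted point `e 2` of the final frame.
  obtain ⟨Y, ⟨s, rfl⟩, hYX⟩ :=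
    (Set.infinite_range_of_injective F₀.mk_pt_injective).exists_notMem_finite (Set.finite_range X)
  set Y := Projectivization.mk ℂ (F₀.pt s) (F₀.pt_ne_zero s) with hY
  have hYβ : Y ∈ β.points := mk_mem_points _ (F₀.normal_pt s) (F₀.form_pt s)
  obtain ⟨F, r, hr, h2⟩ := exists_frame_of_mem_points hβ (hXβ i₀) hYβ
    (fun h => hYX ⟨i₀, h⟩)
  have hmk : ∀ i, ∃ t, X i = Projectivization.mk ℂ (F.pt t) (F.pt_ne_zero t) := fun i => by
    obtain ⟨h1, hq⟩ := hXβ i _ (rep_mem_submodule (X i))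
    rcases F.exists_eq_smul_pt h1 hq with h | ⟨-, t, ht⟩
    · refine (hYX ⟨i, ?_⟩).elim
      change X i = Y
      rw [← (X i).mk_rep, ← Y.mk_rep, Projectivization.mk_eq_mk_iff']
      exact ⟨(F.d 2 ⬝ᵥ (X i).rep) * r, by rw [mul_smul, ← h2, ← h]⟩
    · refine ⟨t, ?_⟩
      rw [← (X i).mk_rep, Projectivization.mk_eq_mk_iff']
      exact ⟨_, ht.symm⟩
  choose t ht using hmk
  exact ⟨F, t, fun i j hij => hX (by rw [ht i, ht j]; simp only [hij]), ht⟩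

end PlaneConic

/-! ### The theorem -/

theorem theorem4p10 (β : PlaneConic) (hβ : β.IsIrreducible)
    (X : Fin 7 → P3) (hX : Function.Injective X) (hXβ : ∀ i, X i ∈ β.points) :
    HoldsForGenericLinesThrough X (fun L =>
      ∃ βs : ℕ → PlaneConic, Tendsto βs atTop (𝓝 β) ∧
        ∀ n, (∀ i, (βs n).Meets (L i)) ∧ (∀ i, X i ∉ (βs n).points)) := by
  obtain ⟨F, t, ht, hXt⟩ := PlaneConic.exists_frame_mk_pt hβ hX hXβ
  have hXspan : ∀ i, (X i).submodule = Submodule.span ℂ {F.pt (t i)} := fun i => by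
    rw [hXt i, Projectivization.submodule_mk]
  obtain ⟨μ, hμ⟩ := exists_topCoeff_weights ht
  obtain ⟨f, hf⟩ := exists_genericity_polynomial t μ (F.d 0 ᵥ* planeSection β.normal)
    (fun i => F.d 0 ᵥ* planeSection (β.form *ᵥ F.pt (t i)))
  have hform : ∀ i p, (β.form *ᵥ F.pt (t i)) ⬝ᵥ p = F.pt (t i) ⬝ᵥ β.form *ᵥ p := fun i p => by
    rw [dotProduct_comm, β.dotProduct_form_comm]
  refine ⟨_, ⟨{f}, rfl⟩, ?_, ?_⟩
  · obtain ⟨c, hc⟩ := exists_moments_eq hμ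
    -- By `form_pt_e_two`, the multiple of `e 2` is the one that makes the coefficient of the `i`-th
    -- equation equal to `c i`.
    let p : Fin 7 → Fin 4 → ℂ := fun i =>
      F.f + ((c i + 2 * (F.pt (t i) ⬝ᵥ β.form *ᵥ F.f)) / F.scale) • F.e 2
    have hp : ∀ i, β.normal ⬝ᵥ p i = 1 := fun i => by
      simp [p, dotProduct_add, dotProduct_smul, F.normal_f, F.normal_e]
    have hpc : ∀ i, -2 * (F.pt (t i) ⬝ᵥ β.form *ᵥ p i) = c i := fun i => by
      simp only [p, Matrix.mulVec_add, Matrix.mulVec_smul, dotProduct_add, dotProduct_smul,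
        smul_eq_mul]
      have h1 := F.form_pt_e_two (t i)
      have h2 := div_mul_cancel₀ (c i + 2 * (F.pt (t i) ⬝ᵥ β.form *ᵥ F.f)) F.scale_ne_zero
      linear_combination
        h2 - (c i + 2 * (F.pt (t i) ⬝ᵥ β.form *ᵥ F.f)) / F.scale * h1
    have hli : ∀ i, LinearIndependent ℂ ![F.pt (t i), p i] := fun i => by
      rw [LinearIndependent.pair_iff]
      intro a b hab
      have hb : b = 0 := by
        simpa [dotProduct_add, dotProduct_smul, F.normal_pt, hp] using
          congrArg (β.normal ⬝ᵥ ·) hab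
      refine ⟨?_, hb⟩
      simpa [hb, F.pt_ne_zero] using hab
    have hrange : ∀ i, Set.range ![F.pt (t i), p i] = {F.pt (t i), p i} := fun i => by
      simp [Matrix.range_cons, Set.pair_comm]
    refine ⟨fun i => ⟨Submodule.span ℂ {F.pt (t i), p i}, ?_⟩, fun i => ?_, fun hZ => ?_⟩
    · rw [← hrange, finrank_span_eq_card (hli i), Fintype.card_fin]
    · change (X i).submodule ≤ Submodule.span ℂ {F.pt (t i), p i}
      rw [hXspan]
      exact Submodule.span_mono (by simp)
    · refine (hf fun i => plucker (F.pt (t i)) (p i)).2 ?_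
        (hZ f rfl (fun i => F.pt (t i)) p fun i => rfl)
      have hA : ∀ i, (F.d 0 ᵥ* planeSection β.normal) ⬝ᵥ plucker (F.pt (t i)) (p i) = -1 :=
        fun i => by
          rw [dotProduct_vecMul_planeSection_plucker, F.normal_pt, hp, F.d_pt]
          simp
      have hG : ∀ i, (F.d 0 ᵥ* planeSection (β.form *ᵥ F.pt (t i))) ⬝ᵥ
          plucker (F.pt (t i)) (p i) = -(F.pt (t i) ⬝ᵥ β.form *ᵥ p i) := fun i => by
        rw [dotProduct_vecMul_planeSection_plucker, hform, hform, F.form_pt, F.d_pt]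
        simp
      simp only [hA, hG, neg_div_neg_eq, div_one, hpc, hc]
      refine ⟨fun _ => by simp, fun i => ?_⟩
      simp [Fin.sum_univ_three, momentCross]
  · intro L hL hLZ
    simp only [Set.mem_ofPred_eq, Set.mem_singleton_iff, forall_eq, not_forall] at hLZ
    obtain ⟨u, v, huv, hne⟩ := hLZ
    obtain ⟨hA, hcross⟩ := (hf fun i => plucker (u i) (v i)).1 hne
    simp only [dotProduct_vecMul_planeSection_plucker] at hA
    let A : Fin 7 → ℂ := fun i =>
      (β.normal ⬝ᵥ u i) * (F.d 0 ⬝ᵥ v i) - (β.normal ⬝ᵥ v i) * (F.d 0 ⬝ᵥ u i)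
    -- The point of `L i` where `F.d 0` vanishes, scaled to `β.normal ⬝ᵥ p i = 1`; `A i ≠ 0` says
    -- that `L i` is not in the plane of `β`.
    let p : Fin 7 → Fin 4 → ℂ := fun i =>
      (A i)⁻¹ • ((F.d 0 ⬝ᵥ v i) • u i - (F.d 0 ⬝ᵥ u i) • v i)
    have hdot : ∀ i x, x ⬝ᵥ p i =
        ((x ⬝ᵥ u i) * (F.d 0 ⬝ᵥ v i) - (x ⬝ᵥ v i) * (F.d 0 ⬝ᵥ u i)) / A i := fun i x => by
      simp only [p, dotProduct_smul, dotProduct_sub, smul_eq_mul]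
      ring
    have hp : ∀ i, β.normal ⬝ᵥ p i = 1 := fun i => by
      rw [hdot]
      exact div_self (hA i)
    have hpL : ∀ i, p i ∈ (L i).1 := fun i => by
      rw [← huv i]
      exact Submodule.smul_mem _ _ (Submodule.sub_mem _
        (Submodule.smul_mem _ _ (Submodule.subset_span (by simp)))
        (Submodule.smul_mem _ _ (Submodule.subset_span (by simp))))
    have hptX : ∀ i, F.pt (t i) ∈ (X i).submodule := fun i => by
      rw [hXspan]
      exact Submodule.mem_span_singleton_self _
    have hspan : ∀ i, Submodule.span ℂ {F.pt (t i), p i} ≤ (L i).1 := fun i => by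
      rw [Submodule.span_le, Set.pair_subset_iff]
      exact ⟨hL i (hptX i), hpL i⟩
    have hratio : ∀ i, (F.d 0 ᵥ* planeSection (β.form *ᵥ F.pt (t i))) ⬝ᵥ plucker (u i) (v i) /
        (F.d 0 ᵥ* planeSection β.normal) ⬝ᵥ plucker (u i) (v i) =
          F.pt (t i) ⬝ᵥ β.form *ᵥ p i := fun i => by
      rw [dotProduct_vecMul_planeSection_plucker, dotProduct_vecMul_planeSection_plucker,
        ← hform, hdot]
    simp only [hratio] at hcross
    obtain ⟨q, hq⟩ := exists_quartic_of_momentCross ht hμ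
      (fun i => -2 * (F.pt (t i) ⬝ᵥ β.form *ᵥ p i))
    -- Nonvanishing at a single node already forces rank two.
    have hs : momentCross (moments t μ fun i => -2 * (F.pt (t i) ⬝ᵥ β.form *ᵥ p i)) ≠ 0 :=
      fun h => hcross 0 (by simp only [h, Pi.zero_apply, zero_mul, Finset.sum_const_zero])
    obtain ⟨βs, hlim, hβs⟩ := F.exists_tendsto t p hp (fun _ => rfl)
      (exists_quartic_add_mul_quadratic ht hμ hs) hq hcross
    refine ⟨βs, hlim, fun n => ⟨fun i => ?_, fun i hi => ?_⟩⟩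
    · obtain ⟨⟨y, hy, hy0, hn, hyq⟩, -⟩ := hβs n i
      refine ⟨Projectivization.mk ℂ y hy0, PlaneConic.mk_mem_points hy0 hn hyq, ?_⟩
      change (Projectivization.mk ℂ y hy0).submodule ≤ (L i).1
      rw [Projectivization.submodule_mk, Submodule.span_singleton_le_iff_mem]
      exact hspan i hy
    · exact (hβs n i).2 (hi _ (hptX i)).1
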